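/- Let $C\subset\mathbb R^n$ be nonempty and compact and let $0<\alpha<\pi/2$. For $v,w\in\mathbb R^n$ put $\max(v)=\max\{v^Tx:x\in C\}$, $\min(v)=\min\{v^Tx:x\in C\}$, $\operatorname{range}(v)=\max(v)-\min(v)$ and $$\operatorname{loss}(v,w)=\max(w)-\min\{w^Tx : x\in C,\ v^Tx=\max(v)\}.$$ Let the random pair $(w,v)$ be generated in one of the following two ways. 1. (Probability Distribution 1) $v=w\cos\alpha+u\sin\alpha$, where $w,u$ are independent standard Gaussian vectors in $\mathbb R^n$. 2. (Probability Distribution 2) $n\ge 2$, and $w=\bar w/\|\bar w\|$, $\hat u=(I-\bar w\bar w^T/\bar w^T\bar w)\bar u$, $u=\hat u/\|\hat u\|$, $v=w\cos\alpha+u\sin\alpha$, where $\bar w,\bar u$ are independent standard Gaussian vectors in $\mathbb R^n$ and $\|\cdot\|$ is the Euclidean norm (so that $w$ and $u$ are almost surely well defined and orthonormal). Then $\operatorname{loss}(v,w)$ and $\operatorname{range}(w)$ are integrable and $$E\,\operatorname{loss}(v,w)=\frac{1-\cos\alpha}{2}\,E\,\operatorname{range}(w).$$ If moreover $C$ has more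 than one point, then $E\,\operatorname{range}(w)>0$ and $$\frac{E\,\operatorname{loss}(v,w)}{E\,\operatorname{range}(w)}=\frac{1-\cos\alpha}{2}.$$ -/

import Mathlib

open MeasureTheory ProbabilityTheory
open scoped RealInnerProductSpace

namespace RobustLoss

noncomputable section

/-- `max(v)`, the maximum of `vᵀx` over `x ∈ C`. -/
def maxVal {n : ℕ} (C : Set (EuclideanSpace ℝ (Fin n))) (v : EuclideanSpace ℝ (Fin n)) : ℝ :=
  sSup ((fun x => ⟪v, x⟫) '' C)

/-- `min(v)`, the minimum of `vᵀx` over `x ∈ C`. -/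
def minVal {n : ℕ} (C : Set (EuclideanSpace ℝ (Fin n))) (v : EuclideanSpace ℝ (Fin n)) : ℝ :=
  sInf ((fun x => ⟪v, x⟫) '' C)

/-- `range(v) = max(v) - min(v)`. -/
def ran {n : ℕ} (C : Set (EuclideanSpace ℝ (Fin n))) (v : EuclideanSpace ℝ (Fin n)) : ℝ :=
  maxVal C v - minVal C v

/-- The optimal solutions in `C` for the nominal objective `vᵀx`. -/
def optSet {n : ℕ} (C : Set (EuclideanSpace ℝ (Fin n))) (v : EuclideanSpace ℝ (Fin n)) :
    Set (EuclideanSpace ℝ (Fin n)) :=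
  {x | x ∈ C ∧ ⟪v, x⟫ = maxVal C v}

/-- `loss(v, w) = max(w) - min {wᵀx : x ∈ C, vᵀx = max(v)}`, where `v` is the nominal objective
and `w` the true one. -/
def loss {n : ℕ} (C : Set (EuclideanSpace ℝ (Fin n))) (v w : EuclideanSpace ℝ (Fin n)) : ℝ :=
  maxVal C w - minVal (optSet C v) w

/-- On a nonempty compact set `maxVal` is an attained maximum. -/
theorem isGreatest_maxVal {n : ℕ} {C : Set (EuclideanSpace ℝ (Fin n))} (hC : IsCompact C)
    (hne : C.Nonempty) (v : EuclideanSpace ℝ (Fin n)) :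
    IsGreatest ((fun x => ⟪v, x⟫) '' C) (maxVal C v) :=
  (hC.image (by fun_prop)).isGreatest_sSup (hne.image _)

/-- On a nonempty compact set `minVal` is an attained minimum. -/
theorem isLeast_minVal {n : ℕ} {C : Set (EuclideanSpace ℝ (Fin n))} (hC : IsCompact C)
    (hne : C.Nonempty) (v : EuclideanSpace ℝ (Fin n)) :
    IsLeast ((fun x => ⟪v, x⟫) '' C) (minVal C v) :=
  (hC.image (by fun_prop)).isLeast_sInf (hne.image _)

/-- The optimal set is nonempty and compact, so the minimum in `loss` is attained too. -/
theorem optSet_nonempty_isCompact {n : ℕ} {C : Set (EuclideanSpace ℝ (Fin n))}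
    (hC : IsCompact C) (hne : C.Nonempty) (v : EuclideanSpace ℝ (Fin n)) :
    (optSet C v).Nonempty ∧ IsCompact (optSet C v) := by
  constructor
  · obtain ⟨x, hx, h⟩ := (isGreatest_maxVal hC hne v).1
    exact ⟨x, hx, h⟩
  · exact hC.inter_right (isClosed_eq (by fun_prop) continuous_const)

/-- `(w, v)` is generated according to Probability Distribution 1 with angle `α`:
`v = w cos α + u sin α` with `w`, `u` independent standard Gaussian vectors. -/
def IsDistribution1 {n : ℕ} {Ω : Type*} [MeasurableSpace Ω] (μ : Measure Ω) (α : ℝ)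
    (w v : Ω → EuclideanSpace ℝ (Fin n)) : Prop :=
  ∃ u : Ω → EuclideanSpace ℝ (Fin n),
    HasLaw w (stdGaussian (EuclideanSpace ℝ (Fin n))) μ ∧
    HasLaw u (stdGaussian (EuclideanSpace ℝ (Fin n))) μ ∧
    IndepFun w u μ ∧
    ∀ᵐ ω ∂μ, v ω = Real.cos α • w ω + Real.sin α • u ω

/-- `a / ‖a‖`. -/
def normalize {n : ℕ} (a : EuclideanSpace ℝ (Fin n)) : EuclideanSpace ℝ (Fin n) :=
  ‖a‖⁻¹ • a

/-- `(I - a aᵀ / aᵀa) b`, the component of `b` orthogonal to `a`. -/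
def orthComponent {n : ℕ} (a b : EuclideanSpace ℝ (Fin n)) : EuclideanSpace ℝ (Fin n) :=
  b - (⟪a, b⟫ / ⟪a, a⟫) • a

/-- `(w, v)` is generated according to Probability Distribution 2 with angle `α`: from independent
standard Gaussian vectors `w'`, `u'`, let `w` be `w'` normalized and `u` the component of `u'`
orthogonal to `w'`, normalized; then `v = w cos α + u sin α`. The divisions are by nonzero numbers
almost surely when `2 ≤ n`. -/
def IsDistribution2 {n : ℕ} {Ω : Type*} [MeasurableSpace Ω] (μ : Measure Ω) (α : ℝ)
    (w v : Ω → EuclideanSpace ℝ (Fin n)) : Prop :=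
  ∃ w' u' : Ω → EuclideanSpace ℝ (Fin n),
    HasLaw w' (stdGaussian (EuclideanSpace ℝ (Fin n))) μ ∧
    HasLaw u' (stdGaussian (EuclideanSpace ℝ (Fin n))) μ ∧
    IndepFun w' u' μ ∧
    (∀ᵐ ω ∂μ, w ω = normalize (w' ω)) ∧
    ∀ᵐ ω ∂μ, v ω = Real.cos α • w ω + Real.sin α • normalize (orthComponent (w' ω) (u' ω))

end

end RobustLoss

/-! Let `h = maxVal C` be the support function: Lipschitz, positively homogeneous, and
differentiable almost everywhere by Rademacher. Where `h` is differentiable at `v`, its gradient is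
the only maximizer of `⟪v, ·⟫`, so the minimum in the loss is `Dh(v) w`. Rotate the pair `(w, u)` by
`α` to `(v, u')`; then `w = cos α • v - sin α • u'`, and Euler's identity `Dh(v) v = h(v)` gives
`loss = h(w) - cos α * h(v) + sin α * Dh(v) u'`. If the law of `(w, u)` is invariant under rotations
of the pair and under `u ↦ -u`, then `h(v)` and `h(w)` have equal means, `Dh(v) u'` has mean zero,
and `ran C w = h(w) + h(-w)` has mean `2 E h(w)`, which is the claim (`integral_loss_of_invariant`).
Gaussian pairs have these symmetries. For normalized pairs, rotation invariance follows from
uniqueness of the invariant probability measure on an orbit of the orthogonal group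
(`eq_of_invariant`, `frameLaw_map_rotation`). -/

namespace RobustLoss

/-! ### The support function and its gradient. -/

section SupportFunction

variable {n : ℕ} {C : Set (EuclideanSpace ℝ (Fin n))}

lemma inner_le_maxVal (hC : IsCompact C) (hne : C.Nonempty) (v : EuclideanSpace ℝ (Fin n))
    {x : EuclideanSpace ℝ (Fin n)} (hx : x ∈ C) : ⟪v, x⟫ ≤ maxVal C v :=
  (isGreatest_maxVal hC hne v).2 ⟨x, hx, rfl⟩

/-- Any norm bound for `C` is a Lipschitz constant. This feeds Rademacher's theorem and the
integrability bounds. -/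
lemma exists_lipschitzWith_maxVal (hC : IsCompact C) (hne : C.Nonempty) :
    ∃ K, LipschitzWith K (maxVal C) := by
  obtain ⟨R, hR⟩ := hC.isBounded.exists_norm_le
  refine ⟨R.toNNReal, LipschitzWith.of_le_add_mul _ fun v v' => ?_⟩
  obtain ⟨x, hx, h⟩ := (isGreatest_maxVal hC hne v).1
  have h1 : ⟪v, x⟫ = ⟪v', x⟫ + ⟪v - v', x⟫ := by rw [inner_sub_left]; ring
  have h2 := inner_le_maxVal hC hne v' hx
  have h3 := real_inner_le_norm (v - v') x
  have h4 : ‖v - v'‖ * ‖x‖ ≤ R.toNNReal * ‖v - v'‖ := by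
    rw [mul_comm]
    gcongr
    exact (hR x hx).trans (Real.le_coe_toNNReal R)
  simp only at h
  rw [dist_eq_norm]
  linarith

lemma minVal_eq_neg_maxVal_neg (hC : IsCompact C) (hne : C.Nonempty)
    (v : EuclideanSpace ℝ (Fin n)) : minVal C v = -maxVal C (-v) := by
  refine (isLeast_minVal hC hne v).unique ⟨?_, ?_⟩
  · obtain ⟨x, hx, h⟩ := (isGreatest_maxVal hC hne (-v)).1
    exact ⟨x, hx, by simp only [inner_neg_left] at h ⊢; linarith⟩
  · rintro _ ⟨x, hx, rfl⟩
    have := inner_le_maxVal hC hne (-v) hx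
    simp only [inner_neg_left] at this ⊢
    linarith

lemma ran_eq (hC : IsCompact C) (hne : C.Nonempty) (v : EuclideanSpace ℝ (Fin n)) :
    ran C v = maxVal C v + maxVal C (-v) := by
  rw [ran, minVal_eq_neg_maxVal_neg hC hne]; ring

/-- A maximizer of `⟪v, ·⟫` is the gradient of the support function, wherever it is
differentiable. -/
lemma fderiv_maxVal_eq (hC : IsCompact C) (hne : C.Nonempty) {v x : EuclideanSpace ℝ (Fin n)}
    (hd : DifferentiableAt ℝ (maxVal C) v) (hx : x ∈ optSet C v) :
    fderiv ℝ (maxVal C) v = innerSL ℝ x := by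
  have h1 : HasFDerivAt (fun y => maxVal C y - innerSL ℝ x y)
      (fderiv ℝ (maxVal C) v - innerSL ℝ x) v :=
    hd.hasFDerivAt.sub (innerSL ℝ x).hasFDerivAt
  -- The difference is nonnegative everywhere and vanishes at `v`, so `v` is a global minimum.
  have h2 : IsLocalMin (fun y => maxVal C y - innerSL ℝ x y) v := by
    refine Filter.Eventually.of_forall fun y => ?_
    have := inner_le_maxVal hC hne y hx.1
    have hv := hx.2
    simp only [innerSL_apply_apply]
    rw [real_inner_comm] at this hv
    linarith
  exact sub_eq_zero.1 (h2.hasFDerivAt_eq_zero h1)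

/-- Every maximizer represents the same gradient, so differentiability rules out ties and the inner
minimum is over one point. -/
lemma minVal_optSet_eq_fderiv (hC : IsCompact C) (hne : C.Nonempty)
    {v : EuclideanSpace ℝ (Fin n)} (hd : DifferentiableAt ℝ (maxVal C) v)
    (w : EuclideanSpace ℝ (Fin n)) : minVal (optSet C v) w = fderiv ℝ (maxVal C) v w := by
  obtain ⟨h1, h2⟩ := optSet_nonempty_isCompact hC hne v
  obtain ⟨x, hx, h⟩ := (isLeast_minVal h2 h1 w).1
  rw [← h, fderiv_maxVal_eq hC hne hd hx, innerSL_apply_apply, real_inner_comm]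

/-- Euler's identity for a function homogeneous of degree one, read off from a maximizer. -/
lemma fderiv_maxVal_self (hC : IsCompact C) (hne : C.Nonempty)
    {v : EuclideanSpace ℝ (Fin n)} (hd : DifferentiableAt ℝ (maxVal C) v) :
    fderiv ℝ (maxVal C) v v = maxVal C v := by
  obtain ⟨x, hx⟩ := (optSet_nonempty_isCompact hC hne v).1
  rw [fderiv_maxVal_eq hC hne hd hx, innerSL_apply_apply, real_inner_comm, hx.2]

lemma maxVal_smul (hC : IsCompact C) (hne : C.Nonempty) {c : ℝ} (hc : 0 ≤ c)
    (v : EuclideanSpace ℝ (Fin n)) : maxVal C (c • v) = c * maxVal C v := by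
  refine (isGreatest_maxVal hC hne _).unique ⟨?_, ?_⟩
  · obtain ⟨x, hx, h⟩ := (isGreatest_maxVal hC hne v).1
    exact ⟨x, hx, by simp only [real_inner_smul_left] at h ⊢; rw [h]⟩
  · rintro _ ⟨x, hx, rfl⟩
    simp only [real_inner_smul_left]
    exact mul_le_mul_of_nonneg_left (inner_le_maxVal hC hne v hx) hc

/-- By homogeneity the points of differentiability form a cone, so almost everywhere
differentiability passes from Gaussian vectors to their normalizations. -/
lemma differentiableAt_maxVal_smul (hC : IsCompact C) (hne : C.Nonempty) {c : ℝ} (hc : 0 < c)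
    {v : EuclideanSpace ℝ (Fin n)} (hd : DifferentiableAt ℝ (maxVal C) v) :
    DifferentiableAt ℝ (maxVal C) (c • v) := by
  have h : maxVal C = fun y => c * maxVal C (c⁻¹ • y) := by
    ext y
    rw [← maxVal_smul hC hne hc.le, smul_inv_smul₀ hc.ne']
  rw [h]
  refine DifferentiableAt.const_mul (DifferentiableAt.comp (g := maxVal C) (f := fun y => c⁻¹ • y) (c • v) ?_
    (by fun_prop)) c
  rwa [inv_smul_smul₀ hc.ne']

lemma ran_nonneg (hC : IsCompact C) (hne : C.Nonempty) (v : EuclideanSpace ℝ (Fin n)) :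
    0 ≤ ran C v := by
  obtain ⟨x, hx⟩ := hne
  have h1 := inner_le_maxVal hC ⟨x, hx⟩ v hx
  have h2 := inner_le_maxVal hC ⟨x, hx⟩ (-v) hx
  rw [inner_neg_left] at h2
  rw [ran_eq hC ⟨x, hx⟩]
  linarith

lemma inner_sub_le_ran (hC : IsCompact C) {x y : EuclideanSpace ℝ (Fin n)} (hx : x ∈ C)
    (hy : y ∈ C) (v : EuclideanSpace ℝ (Fin n)) : ⟪v, x - y⟫ ≤ ran C v := by
  have h1 := inner_le_maxVal hC ⟨x, hx⟩ v hx
  have h2 := inner_le_maxVal hC ⟨x, hx⟩ (-v) hy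
  rw [inner_neg_left] at h2
  rw [ran_eq hC ⟨x, hx⟩, inner_sub_right]
  linarith

lemma ran_pos (hC : IsCompact C) {x y : EuclideanSpace ℝ (Fin n)} (hx : x ∈ C)
    (hy : y ∈ C) {v : EuclideanSpace ℝ (Fin n)} (hv : ⟪v, x - y⟫ ≠ 0) : 0 < ran C v := by
  rcases lt_or_gt_of_ne hv with h | h
  · have := inner_sub_le_ran hC hy hx v
    rw [← neg_sub, inner_neg_right] at this
    linarith
  · exact h.trans_le (inner_sub_le_ran hC hx hy v)

end SupportFunction

/-! ### The loss identity for an invariant pair law. -/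

section Core

variable {n : ℕ} {C : Set (EuclideanSpace ℝ (Fin n))}
  {ν : Measure (EuclideanSpace ℝ (Fin n) × EuclideanSpace ℝ (Fin n))}

/-- The pair-law form of the loss identity: the law `ν` of `(w, u)` is invariant under rotations
of the pair and under `u ↦ -u`. -/
lemma integral_loss_of_invariant [IsFiniteMeasure ν] (hC : IsCompact C) (hne : C.Nonempty)
    (hrot : ∀ θ, ν.map (ContinuousLinearMap.rotation θ) = ν)
    (hneg : ν.map (fun p => (p.1, -p.2)) = ν)
    (hint : Integrable (fun p => p) ν)
    (hdiff : ∀ᵐ p ∂ν, DifferentiableAt ℝ (maxVal C) p.1) (α : ℝ) :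
    Integrable (fun p => loss C (Real.cos α • p.1 + Real.sin α • p.2) p.1) ν ∧
    Integrable (fun p => ran C p.1) ν ∧
    ∫ p, loss C (Real.cos α • p.1 + Real.sin α • p.2) p.1 ∂ν
      = (1 - Real.cos α) / 2 * ∫ p, ran C p.1 ∂ν := by
  obtain ⟨K, hK⟩ := exists_lipschitzWith_maxVal hC hne
  have hR (θ : ℝ) : MeasurePreserving (ContinuousLinearMap.rotation θ) ν ν :=
    ⟨(ContinuousLinearMap.rotation θ).continuous.measurable, hrot θ⟩
  have hM : Integrable (fun p => maxVal C p.1) ν := by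
    refine Integrable.mono' (g := fun p => ‖maxVal C 0‖ + K * ‖p‖)
      ((integrable_const _).add (hint.norm.const_mul _)) (hK.continuous.comp continuous_fst).aestronglyMeasurable
      (Filter.Eventually.of_forall fun p => ?_)
    have h1 := hK.dist_le_mul p.1 0
    rw [dist_eq_norm, dist_zero_right] at h1
    have h2 := norm_le_norm_add_norm_sub' (maxVal C p.1) (maxVal C 0)
    have h3 : K * ‖p.1‖ ≤ K * ‖p‖ := by gcongr; exact norm_fst_le p
    linarith
  have hD : Integrable (fun p => fderiv ℝ (maxVal C) p.1 p.2) ν := by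
    refine Integrable.mono' (g := fun p => K * ‖p‖) (hint.norm.const_mul _) ?_
      (Filter.Eventually.of_forall fun p => ?_)
    · have : Measurable (fun p : EuclideanSpace ℝ (Fin n) × EuclideanSpace ℝ (Fin n) =>
          fderiv ℝ (maxVal C) p.1) := (measurable_fderiv ℝ (maxVal C)).comp measurable_fst
      exact (isBoundedBilinearMap_apply.continuous.measurable.comp
        (this.prodMk measurable_snd)).aestronglyMeasurable
    · refine (ContinuousLinearMap.le_opNorm _ _).trans ?_
      gcongr
      · exact norm_fderiv_le_of_lipschitz ℝ hK
      · exact norm_snd_le p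
  -- The integrand is odd in the second vector, whose sign change preserves `ν`.
  have hD0 : ∫ p, fderiv ℝ (maxVal C) p.1 p.2 ∂ν = 0 := by
    have hm : Measurable
        (fun p : EuclideanSpace ℝ (Fin n) × EuclideanSpace ℝ (Fin n) => (p.1, -p.2)) := by
      fun_prop
    have h := integral_map (μ := ν) hm.aemeasurable
      (f := fun p => fderiv ℝ (maxVal C) p.1 p.2) (by rw [hneg]; exact hD.1)
    rw [hneg] at h
    simp only [map_neg, integral_neg] at h
    linarith
  have hcompM (θ : ℝ) : Integrable (fun p => maxVal C (ContinuousLinearMap.rotation θ p).1) ν :=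
    (hR θ).integrable_comp_of_integrable hM
  have hcompD (θ : ℝ) : Integrable (fun p => fderiv ℝ (maxVal C)
      (ContinuousLinearMap.rotation θ p).1 (ContinuousLinearMap.rotation θ p).2) ν :=
    (hR θ).integrable_comp_of_integrable hD
  have hintM (θ : ℝ) : ∫ p, maxVal C (ContinuousLinearMap.rotation θ p).1 ∂ν
      = ∫ p, maxVal C p.1 ∂ν := by
    have h := integral_map (μ := ν) (hR θ).measurable.aemeasurable
      (f := fun p => maxVal C p.1) (by rw [hrot]; exact hM.1)
    rw [hrot] at h
    exact h.symm
  have hintD (θ : ℝ) : ∫ p, fderiv ℝ (maxVal C)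
      (ContinuousLinearMap.rotation θ p).1 (ContinuousLinearMap.rotation θ p).2 ∂ν = 0 := by
    have h := integral_map (μ := ν) (hR θ).measurable.aemeasurable
      (f := fun p => fderiv ℝ (maxVal C) p.1 p.2) (by rw [hrot]; exact hD.1)
    rw [hrot, hD0] at h
    exact h.symm
  have hran : ∀ p : EuclideanSpace ℝ (Fin n) × EuclideanSpace ℝ (Fin n),
      ran C p.1 = maxVal C p.1 + maxVal C (ContinuousLinearMap.rotation Real.pi p).1 := by
    intro p
    rw [ran_eq hC hne, ContinuousLinearMap.rotation_apply]
    simp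
  have hloss : (fun p => loss C (Real.cos α • p.1 + Real.sin α • p.2) p.1) =ᵐ[ν]
      fun p => maxVal C p.1
        - Real.cos α * maxVal C (ContinuousLinearMap.rotation α p).1
        + Real.sin α * fderiv ℝ (maxVal C) (ContinuousLinearMap.rotation α p).1
          (ContinuousLinearMap.rotation α p).2 := by
    filter_upwards [(hR α).quasiMeasurePreserving.ae hdiff] with p hp
    have h1 : Real.cos α • p.1 + Real.sin α • p.2 = (ContinuousLinearMap.rotation α p).1 := by
      rw [ContinuousLinearMap.rotation_apply]
    have h2 : p.1 = Real.cos α • (ContinuousLinearMap.rotation α p).1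
        - Real.sin α • (ContinuousLinearMap.rotation α p).2 := by
      rw [ContinuousLinearMap.rotation_apply]
      have := Real.cos_sq_add_sin_sq α
      have e : p.1 = (Real.cos α ^ 2 + Real.sin α ^ 2) • p.1 := by rw [this, one_smul]
      conv_lhs => rw [e]
      module
    rw [h1, loss, minVal_optSet_eq_fderiv hC hne hp]
    conv_lhs => enter [2]; rw [h2]
    rw [map_sub, map_smul, map_smul, fderiv_maxVal_self hC hne hp, smul_eq_mul, smul_eq_mul]
    ring
  refine ⟨?_, ?_, ?_⟩
  · rw [integrable_congr hloss]
    exact (hM.sub ((hcompM α).const_mul _)).add ((hcompD α).const_mul _)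
  · simp_rw [hran]
    exact hM.add (hcompM _)
  · have h1 : Integrable (fun p => maxVal C p.1
        - Real.cos α * maxVal C (ContinuousLinearMap.rotation α p).1) ν :=
      hM.sub ((hcompM α).const_mul _)
    rw [integral_congr_ae hloss, integral_add h1 ((hcompD α).const_mul _),
      integral_sub hM ((hcompM α).const_mul _), integral_const_mul, integral_const_mul, hintM,
      hintD]
    simp_rw [hran]
    rw [integral_add hM (hcompM _), hintM]
    ring

end Core

/-! ### Null sets and reflection symmetry of the standard Gaussian. -/

section Gaussian

lemma pi_absolutelyContinuous {μ ν : Measure ℝ} [SigmaFinite μ] [SigmaFinite ν] (h : μ ≪ ν) :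
    ∀ n : ℕ, Measure.pi (fun _ : Fin n => μ) ≪ Measure.pi (fun _ : Fin n => ν)
  | 0 => by rw [Measure.pi_of_empty, Measure.pi_of_empty]
  | n + 1 => by
    have h1 := (measurePreserving_piFinSuccAbove (fun _ : Fin (n + 1) => μ) 0).symm
    have h2 := (measurePreserving_piFinSuccAbove (fun _ : Fin (n + 1) => ν) 0).symm
    rw [← h1.map_eq, ← h2.map_eq]
    exact (h.prod (pi_absolutelyContinuous h n)).map h1.measurable

lemma stdGaussian_absolutelyContinuous (n : ℕ) :
    stdGaussian (EuclideanSpace ℝ (Fin n)) ≪ volume := by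
  rw [← map_pi_eq_stdGaussian, ← (PiLp.volume_preserving_toLp (Fin n)).map_eq]
  exact (pi_absolutelyContinuous (gaussianReal_absolutelyContinuous 0 one_ne_zero) n).map
    (PiLp.volume_preserving_toLp (Fin n)).measurable

lemma ae_stdGaussian_notMem {n : ℕ} (s : Submodule ℝ (EuclideanSpace ℝ (Fin n))) (hs : s ≠ ⊤) :
    ∀ᵐ x ∂stdGaussian (EuclideanSpace ℝ (Fin n)), x ∉ s :=
  (stdGaussian_absolutelyContinuous n).ae_le
    (measure_eq_zero_iff_ae_notMem.1 (Measure.addHaar_submodule volume s hs))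

lemma stdGaussian_prod_map_neg_snd (n : ℕ) :
    ((stdGaussian (EuclideanSpace ℝ (Fin n))).prod (stdGaussian (EuclideanSpace ℝ (Fin n)))).map
      (fun p => (p.1, -p.2)) =
    (stdGaussian (EuclideanSpace ℝ (Fin n))).prod (stdGaussian (EuclideanSpace ℝ (Fin n))) := by
  have h1 : MeasurePreserving (fun x : EuclideanSpace ℝ (Fin n) => -x)
      (stdGaussian (EuclideanSpace ℝ (Fin n))) (stdGaussian (EuclideanSpace ℝ (Fin n))) :=
    ⟨measurable_neg, stdGaussian_map (LinearIsometryEquiv.neg ℝ)⟩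
  exact ((MeasurePreserving.id _).prod h1).map_eq

end Gaussian

/-! ### Uniqueness of invariant measures on an orbit. -/

section Invariance

/-- Average `f (g⁻¹ • x)` over the group and swap integrals: invariance of `μ` makes the average
over `x` independent of `g`, and invariance of Haar measure makes the average over `g` independent
of `x` in the orbit. The resulting value no longer involves `μ`. -/
lemma lintegral_eq_haar_of_invariant {G X : Type*} [Group G] [TopologicalSpace G]
    [IsTopologicalGroup G] [CompactSpace G] [SecondCountableTopology G] [MeasurableSpace G]
    [BorelSpace G] [TopologicalSpace X] [MeasurableSpace X] [BorelSpace X] [MulAction G X]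
    [ContinuousSMul G X] {μ : Measure X} [IsProbabilityMeasure μ]
    (hμ : ∀ g : G, μ.map (g • ·) = μ) {x₀ : X} (hx₀ : ∀ᵐ x ∂μ, ∃ g : G, x = g • x₀)
    {f : X → ENNReal} (hf : Continuous f) :
    ∫⁻ x, f x ∂μ = ∫⁻ g : G, f (g⁻¹ • x₀) ∂Measure.haarMeasure ⊤ := by
  set m : Measure G := Measure.haarMeasure ⊤
  have hm : m Set.univ = 1 := Measure.haarMeasure_self (K₀ := ⊤)
  have : IsProbabilityMeasure m := ⟨hm⟩
  have h1 (g : G) : ∫⁻ x, f (g⁻¹ • x) ∂μ = ∫⁻ x, f x ∂μ := by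
    have hg : Measurable (fun x : X => g⁻¹ • x) := (continuous_const_smul g⁻¹).measurable
    conv_rhs => rw [← hμ g⁻¹, lintegral_map hf.measurable hg]
  have h2 : ∀ᵐ x ∂μ, ∫⁻ g : G, f (g⁻¹ • x) ∂m = ∫⁻ g : G, f (g⁻¹ • x₀) ∂m := by
    filter_upwards [hx₀] with x hx
    obtain ⟨h, rfl⟩ := hx
    -- Replacing `g` by `h⁻¹ * g` turns `g⁻¹ • x₀` into `g⁻¹ • h • x₀`; with the inverse in the
    -- action, left invariance suffices.
    rw [← lintegral_mul_left_eq_self (fun g : G => f (g⁻¹ • x₀)) h⁻¹]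
    simp only [mul_inv_rev, inv_inv, mul_smul]
  calc ∫⁻ x, f x ∂μ = ∫⁻ g : G, ∫⁻ x, f (g⁻¹ • x) ∂μ ∂m := by
        simp_rw [h1, lintegral_const, hm, mul_one]
    _ = ∫⁻ x, ∫⁻ g : G, f (g⁻¹ • x) ∂m ∂μ := by
        refine lintegral_lintegral_swap (Continuous.measurable ?_).aemeasurable
        exact hf.comp (continuous_fst.inv.smul continuous_snd)
    _ = ∫⁻ g : G, f (g⁻¹ • x₀) ∂m := by
        rw [lintegral_congr_ae h2, lintegral_const, measure_univ, mul_one]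

/-- Two probability measures that are invariant under a compact group and carried by the same
orbit are equal. -/
lemma eq_of_invariant (G : Type*) {X : Type*} [Group G] [TopologicalSpace G]
    [IsTopologicalGroup G] [CompactSpace G] [SecondCountableTopology G]
    [PseudoMetricSpace X] [MeasurableSpace X] [BorelSpace X] [MulAction G X]
    [ContinuousSMul G X] {μ ν : Measure X} [IsProbabilityMeasure μ] [IsProbabilityMeasure ν]
    (hμ : ∀ g : G, μ.map (g • ·) = μ) (hν : ∀ g : G, ν.map (g • ·) = ν) (x₀ : X)
    (hμ₀ : ∀ᵐ x ∂μ, ∃ g : G, x = g • x₀) (hν₀ : ∀ᵐ x ∂ν, ∃ g : G, x = g • x₀) : μ = ν := by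
  borelize G
  refine ext_of_forall_lintegral_eq_of_IsFiniteMeasure fun f => ?_
  have hf : Continuous fun x => (f x : ENNReal) := ENNReal.continuous_coe.comp f.continuous
  rw [lintegral_eq_haar_of_invariant hμ hμ₀ hf, lintegral_eq_haar_of_invariant hν hν₀ hf]

end Invariance

/-! ### The orthogonal group: compactness and transitivity on orthonormal families. -/

section Orthogonal

variable {E : Type*} [NormedAddCommGroup E] [InnerProductSpace ℝ E] [FiniteDimensional ℝ E]

instance compactSpace_unitary : CompactSpace (unitary (E →L[ℝ] E)) := by
  have : ProperSpace (E →L[ℝ] E) := FiniteDimensional.proper ℝ _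
  refine isCompact_iff_compactSpace.1 (Metric.isCompact_of_isClosed_isBounded isClosed_unitary ?_)
  refine isBounded_iff_forall_norm_le.2 ⟨1, fun x hx => ?_⟩
  refine ContinuousLinearMap.opNorm_le_bound _ zero_le_one fun y => ?_
  have := (Unitary.linearIsometryEquiv ⟨x, hx⟩).norm_map y
  rw [one_mul]
  exact this.le

instance secondCountable_unitary : SecondCountableTopology (unitary (E →L[ℝ] E)) := by
  have : ProperSpace (E →L[ℝ] E) := FiniteDimensional.proper ℝ _
  infer_instance

instance isTopologicalGroup_unitary : IsTopologicalGroup (unitary (E →L[ℝ] E)) := inferInstance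

lemma unitary_smul_eq (g : unitary (E →L[ℝ] E)) (x : E) :
    g • x = Unitary.linearIsometryEquiv g x := rfl

instance : ContinuousSMul (unitary (E →L[ℝ] E)) E :=
  ⟨(isBoundedBilinearMap_apply (𝕜 := ℝ) (E := E) (F := E)).continuous.comp
    ((continuous_subtype_val.comp continuous_fst).prodMk continuous_snd)⟩

/-- The orthogonal group acts transitively on orthonormal families. -/
lemma exists_unitary_smul_eq {ι : Type*} {a b : ι → E} (ha : Orthonormal ℝ a)
    (hb : Orthonormal ℝ b) : ∃ g : unitary (E →L[ℝ] E), ∀ i, b i = g • a i := by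
  have hsa : Orthonormal ℝ (Module.Basis.span ha.linearIndependent) := by
    have h : Subtype.val ∘ Module.Basis.span ha.linearIndependent = a :=
      funext fun i => congrArg Subtype.val (Module.Basis.span_apply ha.linearIndependent i)
    rw [← (Submodule.subtypeₗᵢ (Submodule.span ℝ (Set.range a))).orthonormal_comp_iff]
    exact h.symm ▸ ha
  have hsb : Orthonormal ℝ (Module.Basis.span hb.linearIndependent) := by
    have h : Subtype.val ∘ Module.Basis.span hb.linearIndependent = b :=
      funext fun i => congrArg Subtype.val (Module.Basis.span_apply hb.linearIndependent i)
    rw [← (Submodule.subtypeₗᵢ (Submodule.span ℝ (Set.range b))).orthonormal_comp_iff]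
    exact h.symm ▸ hb
  -- The isometry between the two spans matching the families, which then extends to the whole space
  -- by finite dimensionality.
  let L := (Submodule.subtypeₗᵢ (Submodule.span ℝ (Set.range b))).comp
    (hsa.equiv hsb (Equiv.refl ι)).toLinearIsometry
  refine ⟨Unitary.linearIsometryEquiv.symm (L.extend.toLinearIsometryEquiv rfl), fun i => ?_⟩
  have h := L.extend_apply (Module.Basis.span ha.linearIndependent i)
  have hL : L (Module.Basis.span ha.linearIndependent i) = b i := by
    change ((hsa.equiv hsb (Equiv.refl ι)) (Module.Basis.span ha.linearIndependent i) : E) = b i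
    rw [Orthonormal.equiv_apply, Module.Basis.span_apply, Equiv.refl_apply]
  rw [hL, Module.Basis.span_apply] at h
  rw [unitary_smul_eq, MulEquiv.apply_symm_apply, LinearIsometry.coe_toLinearIsometryEquiv, h]

end Orthogonal

/-! ### Gram–Schmidt frames and their symmetries. -/

section Frame

variable {n : ℕ}

lemma measurable_normalize : Measurable (normalize (n := n)) := by
  unfold normalize; fun_prop

lemma measurable_orthComponent : Measurable
    (fun p : EuclideanSpace ℝ (Fin n) × EuclideanSpace ℝ (Fin n) => orthComponent p.1 p.2) := by
  unfold orthComponent; fun_prop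

lemma normalize_map (g : EuclideanSpace ℝ (Fin n) ≃ₗᵢ[ℝ] EuclideanSpace ℝ (Fin n))
    (a : EuclideanSpace ℝ (Fin n)) : normalize (g a) = g (normalize a) := by
  simp [normalize]

lemma orthComponent_map (g : EuclideanSpace ℝ (Fin n) ≃ₗᵢ[ℝ] EuclideanSpace ℝ (Fin n))
    (a b : EuclideanSpace ℝ (Fin n)) :
    orthComponent (g a) (g b) = g (orthComponent a b) := by
  simp only [orthComponent, LinearIsometryEquiv.inner_map_map, map_sub, map_smul]

lemma norm_normalize {a : EuclideanSpace ℝ (Fin n)} (ha : a ≠ 0) : ‖normalize a‖ = 1 := by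
  rw [normalize, norm_smul, norm_inv, norm_norm, inv_mul_cancel₀ (norm_ne_zero_iff.2 ha)]

lemma inner_orthComponent (a b : EuclideanSpace ℝ (Fin n)) : ⟪a, orthComponent a b⟫ = 0 := by
  rcases eq_or_ne a 0 with rfl | ha
  · simp
  · rw [orthComponent, inner_sub_right, inner_smul_right,
      div_mul_cancel₀ _ (inner_self_ne_zero.2 ha), sub_self]

/-- The orthonormal pair obtained from a pair of vectors by the Gram–Schmidt process. -/
noncomputable def frame (p : EuclideanSpace ℝ (Fin n) × EuclideanSpace ℝ (Fin n)) :
    EuclideanSpace ℝ (Fin n) × EuclideanSpace ℝ (Fin n) :=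
  (normalize p.1, normalize (orthComponent p.1 p.2))

lemma measurable_frame : Measurable (frame (n := n)) :=
  (measurable_normalize.comp measurable_fst).prodMk
    (measurable_normalize.comp measurable_orthComponent)

lemma frame_smul (g : unitary (EuclideanSpace ℝ (Fin n) →L[ℝ] EuclideanSpace ℝ (Fin n)))
    (p : EuclideanSpace ℝ (Fin n) × EuclideanSpace ℝ (Fin n)) :
    frame (g • p) = g • frame p := by
  simp only [frame, Prod.smul_mk, Prod.smul_fst, Prod.smul_snd, unitary_smul_eq, normalize_map,
    orthComponent_map]

lemma frame_neg_snd (p : EuclideanSpace ℝ (Fin n) × EuclideanSpace ℝ (Fin n)) :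
    frame (p.1, -p.2) = ((frame p).1, -(frame p).2) := by
  have h : orthComponent p.1 (-p.2) = -orthComponent p.1 p.2 := by
    simp only [orthComponent, inner_neg_right]
    module
  simp [frame, h, normalize]

/-- The pair consists of orthogonal unit vectors. -/
def IsOrthonormalPair (p : EuclideanSpace ℝ (Fin n) × EuclideanSpace ℝ (Fin n)) : Prop :=
  ‖p.1‖ = 1 ∧ ‖p.2‖ = 1 ∧ ⟪p.1, p.2⟫ = 0

lemma measurableSet_isOrthonormalPair : MeasurableSet {p | IsOrthonormalPair (n := n) p} := by
  have h1 : IsClosed {p : EuclideanSpace ℝ (Fin n) × EuclideanSpace ℝ (Fin n) | ‖p.1‖ = 1} :=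
    isClosed_eq (by fun_prop) (by fun_prop)
  have h2 : IsClosed {p : EuclideanSpace ℝ (Fin n) × EuclideanSpace ℝ (Fin n) | ‖p.2‖ = 1} :=
    isClosed_eq (by fun_prop) (by fun_prop)
  have h3 : IsClosed
      {p : EuclideanSpace ℝ (Fin n) × EuclideanSpace ℝ (Fin n) | ⟪p.1, p.2⟫ = (0 : ℝ)} :=
    isClosed_eq (by fun_prop) (by fun_prop)
  exact (h1.inter (h2.inter h3)).measurableSet

lemma IsOrthonormalPair.orthonormal
    {p : EuclideanSpace ℝ (Fin n) × EuclideanSpace ℝ (Fin n)} (hp : IsOrthonormalPair p) :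
    Orthonormal ℝ ![p.1, p.2] := by
  obtain ⟨h1, h2, h3⟩ := hp
  constructor
  · intro i; fin_cases i <;> simpa
  · intro i j hij
    fin_cases i <;> fin_cases j <;> simp_all [real_inner_comm]

lemma IsOrthonormalPair.exists_smul_eq
    {p q : EuclideanSpace ℝ (Fin n) × EuclideanSpace ℝ (Fin n)} (hp : IsOrthonormalPair p)
    (hq : IsOrthonormalPair q) :
    ∃ g : unitary (EuclideanSpace ℝ (Fin n) →L[ℝ] EuclideanSpace ℝ (Fin n)), q = g • p := by
  obtain ⟨g, hg⟩ := exists_unitary_smul_eq hp.orthonormal hq.orthonormal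
  exact ⟨g, Prod.ext (hg 0) (hg 1)⟩

lemma IsOrthonormalPair.rotation
    {p : EuclideanSpace ℝ (Fin n) × EuclideanSpace ℝ (Fin n)} (hp : IsOrthonormalPair p) (θ : ℝ) :
    IsOrthonormalPair (ContinuousLinearMap.rotation θ p) := by
  obtain ⟨h1, h2, h3⟩ := hp
  have h4 : ⟪p.2, p.1⟫ = 0 := by rw [real_inner_comm, h3]
  have h5 : ⟪p.1, p.1⟫ = 1 := by rw [real_inner_self_eq_norm_sq, h1, one_pow]
  have h6 : ⟪p.2, p.2⟫ = 1 := by rw [real_inner_self_eq_norm_sq, h2, one_pow]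
  have hsq (x : EuclideanSpace ℝ (Fin n)) (hx : ⟪x, x⟫ = 1) : ‖x‖ = 1 := by
    rw [norm_eq_sqrt_real_inner, hx, Real.sqrt_one]
  have := Real.cos_sq_add_sin_sq θ
  rw [ContinuousLinearMap.rotation_apply]
  refine ⟨hsq _ ?_, hsq _ ?_, ?_⟩ <;>
  · simp only [inner_add_left, inner_add_right, real_inner_smul_left, inner_smul_right, h3, h4, h5,
      h6]
    linarith

lemma isOrthonormalPair_frame {p : EuclideanSpace ℝ (Fin n) × EuclideanSpace ℝ (Fin n)}
    (h1 : p.1 ≠ 0) (h2 : orthComponent p.1 p.2 ≠ 0) : IsOrthonormalPair (frame p) := by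
  refine ⟨norm_normalize h1, norm_normalize h2, ?_⟩
  simp [frame, normalize, real_inner_smul_left, inner_smul_right, inner_orthComponent]

lemma smul_rotation (g : unitary (EuclideanSpace ℝ (Fin n) →L[ℝ] EuclideanSpace ℝ (Fin n)))
    (p : EuclideanSpace ℝ (Fin n) × EuclideanSpace ℝ (Fin n)) (θ : ℝ) :
    g • ContinuousLinearMap.rotation θ p = ContinuousLinearMap.rotation θ (g • p) := by
  simp only [ContinuousLinearMap.rotation_apply, Prod.smul_mk, Prod.smul_fst, Prod.smul_snd,
    unitary_smul_eq, map_add, map_smul]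

end Frame

/-! ### Gaussian pairs, frame laws, and their invariance. -/

section FrameLaw

variable (n : ℕ)

/-- The law of a pair of independent standard Gaussian vectors. -/
noncomputable def gaussianPair :
    Measure (EuclideanSpace ℝ (Fin n) × EuclideanSpace ℝ (Fin n)) :=
  (stdGaussian (EuclideanSpace ℝ (Fin n))).prod (stdGaussian (EuclideanSpace ℝ (Fin n)))

instance : IsProbabilityMeasure (gaussianPair n) := by
  unfold gaussianPair; infer_instance

/-- The law of the Gram–Schmidt frame of a pair of independent standard Gaussian vectors. -/
noncomputable def frameLaw : Measure (EuclideanSpace ℝ (Fin n) × EuclideanSpace ℝ (Fin n)) :=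
  (gaussianPair n).map frame

instance : IsProbabilityMeasure (frameLaw n) :=
  Measure.isProbabilityMeasure_map measurable_frame.aemeasurable

variable {n}

lemma ae_gaussianPair_fst {P : EuclideanSpace ℝ (Fin n) → Prop}
    (h : ∀ᵐ x ∂stdGaussian (EuclideanSpace ℝ (Fin n)), P x) : ∀ᵐ p ∂gaussianPair n, P p.1 :=
  Measure.quasiMeasurePreserving_fst.ae h

lemma gaussianPair_map_smul
    (g : unitary (EuclideanSpace ℝ (Fin n) →L[ℝ] EuclideanSpace ℝ (Fin n))) :
    (gaussianPair n).map (g • ·) = gaussianPair n := by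
  have h : MeasurePreserving (Unitary.linearIsometryEquiv g)
      (stdGaussian (EuclideanSpace ℝ (Fin n))) (stdGaussian (EuclideanSpace ℝ (Fin n))) :=
    ⟨(Unitary.linearIsometryEquiv g).continuous.measurable, stdGaussian_map _⟩
  exact (h.prod h).map_eq

lemma measurable_smul_pair
    (g : unitary (EuclideanSpace ℝ (Fin n) →L[ℝ] EuclideanSpace ℝ (Fin n))) :
    Measurable
      (fun p : EuclideanSpace ℝ (Fin n) × EuclideanSpace ℝ (Fin n) => g • p) :=
  ((Unitary.linearIsometryEquiv g).continuous.measurable.comp measurable_fst).prodMk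
    ((Unitary.linearIsometryEquiv g).continuous.measurable.comp measurable_snd)

lemma frameLaw_map_smul
    (g : unitary (EuclideanSpace ℝ (Fin n) →L[ℝ] EuclideanSpace ℝ (Fin n))) :
    (frameLaw n).map (g • ·) = frameLaw n := by
  conv_rhs => rw [frameLaw, ← gaussianPair_map_smul g]
  rw [frameLaw, Measure.map_map (measurable_smul_pair g) measurable_frame,
    Measure.map_map measurable_frame (measurable_smul_pair g)]
  congr 1
  ext1 p
  exact (frame_smul g p).symm

lemma frameLaw_map_neg_snd : (frameLaw n).map (fun p => (p.1, -p.2)) = frameLaw n := by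
  have hm : Measurable
      (fun p : EuclideanSpace ℝ (Fin n) × EuclideanSpace ℝ (Fin n) => (p.1, -p.2)) := by
    fun_prop
  have hg : (gaussianPair n).map (fun p => (p.1, -p.2)) = gaussianPair n :=
    stdGaussian_prod_map_neg_snd n
  conv_rhs => rw [frameLaw, ← hg]
  rw [frameLaw, Measure.map_map hm measurable_frame, Measure.map_map measurable_frame hm]
  congr 1
  ext1 p
  exact (frame_neg_snd p).symm

lemma ae_gaussianPair_fst_ne_zero (hn : 2 ≤ n) : ∀ᵐ p ∂gaussianPair n, p.1 ≠ 0 := by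
  have : Nonempty (Fin n) := ⟨⟨0, by omega⟩⟩
  have h : ∀ᵐ x ∂stdGaussian (EuclideanSpace ℝ (Fin n)), x ≠ 0 :=
    (ae_stdGaussian_notMem ⊥ bot_ne_top).mono fun x hx => by simpa using hx
  exact ae_gaussianPair_fst h

lemma ae_gaussianPair_orthComponent_ne_zero (hn : 2 ≤ n) :
    ∀ᵐ p ∂gaussianPair n, orthComponent p.1 p.2 ≠ 0 := by
  have hm : MeasurableSet {p : EuclideanSpace ℝ (Fin n) × EuclideanSpace ℝ (Fin n) |
      orthComponent p.1 p.2 ≠ 0} :=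
    measurable_orthComponent (measurableSet_singleton 0).compl
  refine (Measure.ae_prod_mem_iff_ae_ae_mem hm).2 (Filter.Eventually.of_forall fun a => ?_)
  -- A vanishing orthogonal component puts `b` on the line through `a`, a proper and hence null
  -- subspace since `n ≥ 2`.
  have hs : Submodule.span ℝ {a} ≠ ⊤ := by
    intro h
    have h1 := (finrank_span_finset_le_card (R := ℝ) {a}).trans_eq (Finset.card_singleton a)
    rw [Set.finrank, Finset.coe_singleton, h, finrank_top, finrank_euclideanSpace_fin] at h1
    omega
  refine (ae_stdGaussian_notMem _ hs).mono fun b hb h => hb ?_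
  exact Submodule.mem_span_singleton.2 ⟨_, (sub_eq_zero.1 h).symm⟩

lemma ae_frameLaw_isOrthonormalPair (hn : 2 ≤ n) :
    ∀ᵐ p ∂frameLaw n, IsOrthonormalPair p := by
  rw [frameLaw, ae_map_iff measurable_frame.aemeasurable measurableSet_isOrthonormalPair]
  filter_upwards [ae_gaussianPair_fst_ne_zero hn, ae_gaussianPair_orthComponent_ne_zero hn]
    with p h1 h2 using isOrthonormalPair_frame h1 h2

/-- Rotating within the pair commutes with the orthogonal group and preserves orthonormality, so the
rotated law is again an invariant probability measure on the single orbit of orthonormal pairs. -/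
lemma frameLaw_map_rotation (hn : 2 ≤ n) (θ : ℝ) :
    (frameLaw n).map (ContinuousLinearMap.rotation θ) = frameLaw n := by
  have hr : Measurable (ContinuousLinearMap.rotation θ :
      EuclideanSpace ℝ (Fin n) × EuclideanSpace ℝ (Fin n) →L[ℝ] _) :=
    (ContinuousLinearMap.rotation θ).continuous.measurable
  have := Measure.isProbabilityMeasure_map (μ := frameLaw n) hr.aemeasurable
  have hae := ae_frameLaw_isOrthonormalPair hn
  obtain ⟨x₀, hx₀⟩ := hae.exists
  refine eq_of_invariant (unitary (EuclideanSpace ℝ (Fin n) →L[ℝ] EuclideanSpace ℝ (Fin n)))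
    (fun g => ?_) frameLaw_map_smul x₀ ?_ (hae.mono fun p hp => hx₀.exists_smul_eq hp)
  · conv_rhs => rw [← frameLaw_map_smul g]
    rw [Measure.map_map (measurable_smul_pair g) hr, Measure.map_map hr (measurable_smul_pair g)]
    congr 1
    ext1 p
    exact smul_rotation g p θ
  · have h : ∀ᵐ p ∂(frameLaw n).map (ContinuousLinearMap.rotation θ), IsOrthonormalPair p := by
      rw [ae_map_iff hr.aemeasurable measurableSet_isOrthonormalPair]
      exact hae.mono fun p hp => hp.rotation θ
    exact h.mono fun p hp => hx₀.exists_smul_eq hp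

lemma integrable_frameLaw (hn : 2 ≤ n) : Integrable (fun p => p) (frameLaw n) := by
  refine Integrable.of_bound measurable_id.aestronglyMeasurable 1 ?_
  filter_upwards [ae_frameLaw_isOrthonormalPair hn] with p hp
  rw [Prod.norm_def, hp.1, hp.2.1, max_self]

lemma integrable_gaussianPair : Integrable (fun p => p) (gaussianPair n) := by
  have h : Integrable (fun x => x) (stdGaussian (EuclideanSpace ℝ (Fin n))) :=
    IsGaussian.integrable_fun_id
  exact (h.comp_fst _).prodMk (h.comp_snd _)

lemma gaussianPair_map_rotation (θ : ℝ) :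
    (gaussianPair n).map (ContinuousLinearMap.rotation θ) = gaussianPair n :=
  IsGaussian.map_rotation_eq_self integral_id_stdGaussian θ

variable {C : Set (EuclideanSpace ℝ (Fin n))}

lemma ae_gaussianPair_differentiableAt (hC : IsCompact C) (hne : C.Nonempty) :
    ∀ᵐ p ∂gaussianPair n, DifferentiableAt ℝ (maxVal C) p.1 := by
  obtain ⟨K, hK⟩ := exists_lipschitzWith_maxVal hC hne
  exact ae_gaussianPair_fst ((stdGaussian_absolutelyContinuous n).ae_le hK.ae_differentiableAt)

lemma ae_frameLaw_differentiableAt (hn : 2 ≤ n) (hC : IsCompact C) (hne : C.Nonempty) :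
    ∀ᵐ p ∂frameLaw n, DifferentiableAt ℝ (maxVal C) p.1 := by
  have hm : MeasurableSet {p : EuclideanSpace ℝ (Fin n) × EuclideanSpace ℝ (Fin n) |
      DifferentiableAt ℝ (maxVal C) p.1} :=
    measurable_fst (measurableSet_of_differentiableAt ℝ (maxVal C))
  rw [frameLaw, ae_map_iff measurable_frame.aemeasurable hm]
  filter_upwards [ae_gaussianPair_differentiableAt hC hne, ae_gaussianPair_fst_ne_zero hn]
    with p h1 h2
  exact differentiableAt_maxVal_smul hC hne (inv_pos.2 (norm_pos_iff.2 h2)) h1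

lemma ae_gaussianPair_inner_ne_zero {d : EuclideanSpace ℝ (Fin n)} (hd : d ≠ 0) :
    ∀ᵐ p ∂gaussianPair n, ⟪p.1, d⟫ ≠ 0 := by
  have hs : (Submodule.span ℝ {d})ᗮ ≠ ⊤ := by simpa using hd
  have h : ∀ᵐ x ∂stdGaussian (EuclideanSpace ℝ (Fin n)), ⟪x, d⟫ ≠ 0 :=
    (ae_stdGaussian_notMem _ hs).mono fun x hx h =>
      hx (Submodule.mem_orthogonal_singleton_iff_inner_left.2 h)
  exact ae_gaussianPair_fst h

lemma ae_frameLaw_inner_ne_zero (hn : 2 ≤ n) {d : EuclideanSpace ℝ (Fin n)} (hd : d ≠ 0) :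
    ∀ᵐ p ∂frameLaw n, ⟪p.1, d⟫ ≠ 0 := by
  have hm : MeasurableSet {p : EuclideanSpace ℝ (Fin n) × EuclideanSpace ℝ (Fin n) |
      ⟪p.1, d⟫ ≠ 0} := (isOpen_ne_fun (by fun_prop) continuous_const).measurableSet
  rw [frameLaw, ae_map_iff measurable_frame.aemeasurable hm]
  filter_upwards [ae_gaussianPair_inner_ne_zero hd, ae_gaussianPair_fst_ne_zero hn] with p h1 h2
  simp [frame, normalize, real_inner_smul_left, h1, h2]

end FrameLaw

/-- Transfer of the loss identity from an invariant pair law to random vectors with that law. -/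
lemma loss_identity_of_hasLaw {n : ℕ} {C : Set (EuclideanSpace ℝ (Fin n))}
    {ν : Measure (EuclideanSpace ℝ (Fin n) × EuclideanSpace ℝ (Fin n))} [IsProbabilityMeasure ν]
    (hC : IsCompact C) (hne : C.Nonempty)
    (hrot : ∀ θ, ν.map (ContinuousLinearMap.rotation θ) = ν)
    (hneg : ν.map (fun p => (p.1, -p.2)) = ν)
    (hint : Integrable (fun p => p) ν)
    (hdiff : ∀ᵐ p ∂ν, DifferentiableAt ℝ (maxVal C) p.1)
    (hinner : ∀ d ≠ 0, ∀ᵐ p ∂ν, ⟪p.1, d⟫ ≠ 0)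
    {Ω : Type*} [MeasurableSpace Ω] {μ : Measure Ω} {w u v : Ω → EuclideanSpace ℝ (Fin n)}
    (hlaw : HasLaw (fun ω => (w ω, u ω)) ν μ) {α : ℝ}
    (hv : ∀ᵐ ω ∂μ, v ω = Real.cos α • w ω + Real.sin α • u ω) :
    Integrable (fun ω => loss C (v ω) (w ω)) μ ∧
    Integrable (fun ω => ran C (w ω)) μ ∧
    (∫ ω, loss C (v ω) (w ω) ∂μ) = (1 - Real.cos α) / 2 * ∫ ω, ran C (w ω) ∂μ ∧
    (C.Nontrivial →
      0 < ∫ ω, ran C (w ω) ∂μ ∧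
      (∫ ω, loss C (v ω) (w ω) ∂μ) / (∫ ω, ran C (w ω) ∂μ) = (1 - Real.cos α) / 2) := by
  obtain ⟨h1, h2, h3⟩ := integral_loss_of_invariant hC hne hrot hneg hint hdiff α
  have hl : (fun ω => loss C (v ω) (w ω)) =ᵐ[μ]
      fun ω => loss C (Real.cos α • w ω + Real.sin α • u ω) (w ω) :=
    hv.mono fun ω h => by simp only [h]
  rw [← hlaw.map_eq] at h1 h2 h3
  rw [integral_map hlaw.aemeasurable h1.1, integral_map hlaw.aemeasurable h2.1] at h3
  have hi2 : Integrable (fun ω => ran C (w ω)) μ := h2.comp_aemeasurable hlaw.aemeasurable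
  rw [integrable_congr hl, integral_congr_ae hl]
  refine ⟨h1.comp_aemeasurable hlaw.aemeasurable, hi2, h3, fun hnt => ?_⟩
  obtain ⟨x, hx, y, hy, hxy⟩ := hnt
  have hpos : 0 < ∫ ω, ran C (w ω) ∂μ := by
    have := hlaw.isProbabilityMeasure
    have hae : ∀ᵐ ω ∂μ, ⟪w ω, x - y⟫ ≠ 0 := by
      have h := hinner _ (sub_ne_zero.2 hxy)
      rw [← hlaw.map_eq] at h
      exact ae_of_ae_map hlaw.aemeasurable h
    rw [integral_pos_iff_support_of_nonneg (fun ω => ran_nonneg hC hne _) hi2]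
    -- A null support would contradict `ran C (w ω) > 0`, which holds whenever `w ω` is not
    -- orthogonal to `x - y`.
    refine pos_iff_ne_zero.2 fun h0 => ?_
    have h4 : ∀ᵐ ω ∂μ, ω ∉ Function.support fun ω => ran C (w ω) :=
      measure_eq_zero_iff_ae_notMem.1 h0
    obtain ⟨ω, ha, hb⟩ := (hae.and h4).exists
    exact hb (ran_pos hC hx hy ha).ne'
  refine ⟨hpos, ?_⟩
  rw [div_eq_iff hpos.ne']
  exact h3

end RobustLoss

theorem mainTheorem1 {n : ℕ} (C : Set (EuclideanSpace ℝ (Fin n)))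
    (hC : IsCompact C) (hne : C.Nonempty)
    (α : ℝ) (hα : 0 < α) (hα' : α < Real.pi / 2)
    {Ω : Type*} [MeasurableSpace Ω] (μ : Measure Ω) [IsProbabilityMeasure μ]
    (w v : Ω → EuclideanSpace ℝ (Fin n))
    (hwv : RobustLoss.IsDistribution1 μ α w v ∨
      (2 ≤ n ∧ RobustLoss.IsDistribution2 μ α w v)) :
    Integrable (fun ω => RobustLoss.loss C (v ω) (w ω)) μ ∧
    Integrable (fun ω => RobustLoss.ran C (w ω)) μ ∧
    (∫ ω, RobustLoss.loss C (v ω) (w ω) ∂μ)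
      = (1 - Real.cos α) / 2 * ∫ ω, RobustLoss.ran C (w ω) ∂μ ∧
    (C.Nontrivial →
      0 < ∫ ω, RobustLoss.ran C (w ω) ∂μ ∧
      (∫ ω, RobustLoss.loss C (v ω) (w ω) ∂μ) / (∫ ω, RobustLoss.ran C (w ω) ∂μ)
        = (1 - Real.cos α) / 2) := by
  rcases hwv with ⟨u, hw, hu, hind, hv⟩ | ⟨hn, w', u', hw', hu', hind, hw, hv⟩
  · exact RobustLoss.loss_identity_of_hasLaw hC hne RobustLoss.gaussianPair_map_rotation
      (RobustLoss.stdGaussian_prod_map_neg_snd n) RobustLoss.integrable_gaussianPair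
      (RobustLoss.ae_gaussianPair_differentiableAt hC hne)
      (fun d hd => RobustLoss.ae_gaussianPair_inner_ne_zero hd)
      (hind.hasLaw_prod hw hu) hv
  · have hpair : HasLaw (fun ω => (w' ω, u' ω)) (RobustLoss.gaussianPair n) μ :=
      hind.hasLaw_prod hw' hu'
    have hframe : HasLaw RobustLoss.frame (RobustLoss.frameLaw n) (RobustLoss.gaussianPair n) :=
      ⟨RobustLoss.measurable_frame.aemeasurable, rfl⟩
    have hlaw : HasLaw (fun ω => (w ω,
        RobustLoss.normalize (RobustLoss.orthComponent (w' ω) (u' ω))))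
        (RobustLoss.frameLaw n) μ :=
      (hframe.fun_comp hpair).congr (hw.mono fun ω h => by simp only [h, RobustLoss.frame])
    exact RobustLoss.loss_identity_of_hasLaw hC hne (RobustLoss.frameLaw_map_rotation hn)
      RobustLoss.frameLaw_map_neg_snd (RobustLoss.integrable_frameLaw hn)
      (RobustLoss.ae_frameLaw_differentiableAt hn hC hne)
      (fun d hd => RobustLoss.ae_frameLaw_inner_ne_zero hn hd) hlaw hv
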